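/- **Setting.** Let $\mathcal X$ be a measurable space of contexts with a probability measure $d_0$, let $\mathcal A$ be a countable set of actions, and let a policy be a Markov kernel $\pi(\cdot\mid x)$ from $\mathcal X$ to $\mathcal A$. Let $\pi_0$ be a reference policy, $\eta>0$, $B>0$, and let $\mathcal R=\{R(\theta,\cdot,\cdot):\theta\in\Theta\}$ be a class of measurable reward functions $\mathcal X\times\mathcal A\to[0,B]$ containing the true reward $R(\theta_*,\cdot,\cdot)$. Put $$Q(\pi)=\mathbb E_{x\sim d_0}\mathbb E_{a\sim\pi(\cdot|x)}\Big[R(\theta_*,x,a)-\eta^{-1}\log\tfrac{\pi(a|x)}{\pi_0(a|x)}\Big],\qquad \pi_\theta^\eta(a|x)\propto\pi_0(a|x)\,e^{\eta R(\theta,x,a)},\qquad \pi^*=\pi_{\theta_*}^\eta .$$ Let $N_{\mathcal R}(r)$ be the smallest cardinality of a set of functions such that every element of $\mathcal R$ is within sup-distance $r$ of one of them. For $\rho=2\eta B$ let $C_\rho$ be the supremum of $\pi(a|x)/\pi_0(a|x)$ over $d_0$-almost all $x$, all $a\in\mathcal A$ and all policies $\pi$ with $\mathbb E_{x\sim d_0}\mathrm{KL}(\pi(\cdot|x)\|\pi_0(\cdot|x))\le\rho$,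 and assume $C_\rho<\infty$ (local KL-ball coverage). **Algorithm.** With $\sigma(u)=1/(1+e^{-u})$, a query $(x,a^1,a^2)$ to the preference oracle returns $y\in\{0,1\}$ with $\mathbb P(y=1)=\sigma(R(\theta_*,x,a^1)-R(\theta_*,x,a^2))$. Stage 1: draw $m$ i.i.d. observations $(x,a^1,a^2,y)$ with $x\sim d_0$ and $a^1,a^2\sim\pi_0(\cdot|x)$ independent given $x$, and let $\hat\theta_0\in\Theta$ maximize over $\theta\in\Theta$ the log-likelihood $$\sum \big[y\log\sigma(R(\theta,x,a^1)-R(\theta,x,a^2))+(1-y)\log\sigma(R(\theta,x,a^2)-R(\theta,x,a^1))\big].$$ Stage 2: given stage 1, draw $n$ i.i.d. observations in the same way with $\pi_{\hat\theta_0}^\eta$ in place of $\pi_0$, and let $\hat\theta\in\Theta$ maximize the log-likelihood of all $m+n$ observations. The output is $\pi_{\hat\theta}^\eta$. (The maximizers are assumed to exist and to be chosen measurably.) **Statement.** For all $c>0$ and $\kappa>0$ there is a constant $K$, depending only on $c$ and $\kappa$, such that for every problem as above, every $\epsilon>0$, every $\delta\in(0,1/6)$ and all sample sizes with $n=c\,m$: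 1. if $\epsilon_c=\dfrac{\epsilon}{2(1+c^{-1})e^B}$, $N_{\mathcal R}(\epsilon_c)<\infty$ and $n\ge\kappa\, C_\rho\,\dfrac{\eta}{\epsilon}\,e^B\log\dfrac{N_{\mathcal R}(\epsilon_c)}{\delta}$, then with probability at least $1-6\delta$ $$Q(\pi^*)-Q(\pi_{\hat\theta}^\eta)\le K\,(1+\eta\,C_\rho)\,\epsilon ;$$ 2. if $\epsilon_c=\dfrac{\epsilon}{2(1+c^{-1})e^B\,\eta\, C_\rho}$, $N_{\mathcal R}(\epsilon_c)<\infty$ and $n\ge\kappa\, C_\rho\,\dfrac{\eta}{\epsilon}\,e^B\log\dfrac{N_{\mathcal R}(\epsilon_c)}{\delta}$, then with probability at least $1-6\delta$ $$Q(\pi^*)-Q(\pi_{\hat\theta}^\eta)\le K\,\epsilon .$$ In particular both hold when $n=c\,m=\Theta\big(C_\rho\,\eta\,\epsilon^{-1}e^B\log(N_{\mathcal R}(\epsilon_c)/\delta)\big)$. -/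

import Mathlib

open MeasureTheory ProbabilityTheory
open scoped ENNReal

/-- A KL-regularized preference-learning problem with contexts in `X`, actions in the countable
discrete space `A` and reward functions `R θ : X → A → [0, B]` indexed by `θ : Θ`.
A policy is a Markov kernel from `X` to `A`. -/
structure PrefProblem (X A Θ : Type*) [MeasurableSpace X] [MeasurableSpace A]
    [MeasurableSpace Θ] where
  /-- context distribution -/
  d₀ : Measure X
  isProb_d₀ : IsProbabilityMeasure d₀
  /-- reference policy -/
  π₀ : Kernel X A
  isMarkov_π₀ : IsMarkovKernel π₀
  /-- parametrized reward functions -/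
  R : Θ → X → A → ℝ
  measurable_R : Measurable fun p : Θ × X × A => R p.1 p.2.1 p.2.2
  /-- bound on the rewards -/
  B : ℝ
  B_pos : 0 < B
  R_nonneg : ∀ θ x a, 0 ≤ R θ x a
  R_le : ∀ θ x a, R θ x a ≤ B
  /-- parameter of the true reward -/
  θstar : Θ
  /-- KL-regularization parameter -/
  η : ℝ
  η_pos : 0 < η

/-- One observation: a context, two actions, and the preference label
(`true` stands for `y = 1`, the first action is preferred). -/
abbrev Obs (X A : Type*) : Type _ := (X × A × A) × Bool

noncomputable section

namespace PrefProblem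

variable {X A Θ : Type*} [MeasurableSpace X] [MeasurableSpace A] [MeasurableSpace Θ]

instance (P : PrefProblem X A Θ) : IsProbabilityMeasure P.d₀ := P.isProb_d₀

instance (P : PrefProblem X A Θ) : IsMarkovKernel P.π₀ := P.isMarkov_π₀

/-- The policies `π_θ^η(a|x) ∝ π₀(a|x) exp (η R(θ, x, a))`, jointly in `(θ, x)`. -/
def gibbs (P : PrefProblem X A Θ) : Kernel (Θ × X) A where
  toFun p := (P.π₀ p.2).tilted fun a => P.η * P.R p.1 p.2 a
  measurable' := by
    have hf : Measurable fun q : (Θ × X) × A => Real.exp (P.η * P.R q.1.1 q.1.2 q.2) :=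
      Real.measurable_exp.comp ((P.measurable_R.comp
        (f := fun q : (Θ × X) × A => (q.1.1, q.1.2, q.2)) (by fun_prop)).const_mul _)
    have hZ : Measurable fun p : Θ × X =>
        ∫ a, Real.exp (P.η * P.R p.1 p.2 a) ∂(P.π₀ p.2) :=
      (StronglyMeasurable.integral_kernel_prod_right' (κ := P.π₀.comap Prod.snd measurable_snd)
        hf.stronglyMeasurable).measurable
    refine Measure.measurable_of_measurable_coe _ fun s hs => ?_
    simp_rw [tilted_apply' _ _ hs]
    exact Measurable.setLIntegral_kernel_prod_right (κ := P.π₀.comap Prod.snd measurable_snd)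
      (f := fun p a => ENNReal.ofReal (Real.exp (P.η * P.R p.1 p.2 a) /
        ∫ a, Real.exp (P.η * P.R p.1 p.2 a) ∂(P.π₀ p.2)))
      ((hf.div (hZ.comp measurable_fst)).ennreal_ofReal) hs

instance (P : PrefProblem X A Θ) : IsMarkovKernel P.gibbs where
  isProbabilityMeasure p := by
    refine isProbabilityMeasure_tilted (Integrable.of_bound
      (C := Real.exp (P.η * P.B)) ?_ (ae_of_all _ fun a => ?_))
    · exact (Real.measurable_exp.comp ((P.measurable_R.comp
        (f := fun a : A => (p.1, p.2, a)) (by fun_prop)).const_mul _)).aestronglyMeasurable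
    · rw [Real.norm_eq_abs, Real.abs_exp]
      exact Real.exp_le_exp.2 (mul_le_mul_of_nonneg_left (P.R_le _ _ _) P.η_pos.le)

/-- The policy `π_θ^η` returned by the planning oracle for the reward `R θ`. -/
def policy (P : PrefProblem X A Θ) (θ : Θ) : Kernel X A := P.gibbs.sectR θ

instance (P : PrefProblem X A Θ) (θ : Θ) : IsMarkovKernel (P.policy θ) := by
  unfold policy; infer_instance

/-- The KL-regularized objective
`Q(π) = E_{x ∼ d₀} E_{a ∼ π(·|x)} [R(θ_*, x, a) - η⁻¹ log (π(a|x) / π₀(a|x))]`. -/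
def objective (P : PrefProblem X A Θ) (π : Kernel X A) : ℝ :=
  ∫ x, ∫ a, (P.R P.θstar x a - P.η⁻¹ * Real.log ((π x).real {a} / (P.π₀ x).real {a}))
    ∂(π x) ∂P.d₀

/-- The suboptimality `Q(π^*) - Q(π_θ^η)`, where `π^* = π_{θ_*}^η`. -/
def gap (P : PrefProblem X A Θ) (θ : Θ) : ℝ :=
  P.objective (P.policy P.θstar) - P.objective (P.policy θ)

/-- The local KL-ball coverage coefficient `C_ρ`: the supremum of `π(a|x) / π₀(a|x)` over
`d₀`-almost all contexts `x`, all actions `a` and all policies `π` with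
`E_{x ∼ d₀} KL(π(·|x) ‖ π₀(·|x)) ≤ ρ`. -/
def localCoverage (P : PrefProblem X A Θ) (ρ : ℝ) : ℝ≥0∞ :=
  ⨆ (π : Kernel X A) (_ : IsMarkovKernel π)
    (_ : ∫⁻ x, InformationTheory.klDiv (π x) (P.π₀ x) ∂P.d₀ ≤ ENNReal.ofReal ρ),
    essSup (fun x => ⨆ a, π x {a} / P.π₀ x {a}) P.d₀

/-- The covering number `N_R(r)` of the class `{R θ | θ ∈ Θ}` in the supremum norm: the least
cardinality of a set `S` of functions such that every `R θ` is within `r` of a member of `S`. -/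
def coveringNumber (P : PrefProblem X A Θ) (r : ℝ) : ℕ∞ :=
  ⨅ (S : Set (X → A → ℝ)) (_ : ∀ θ, ∃ g ∈ S, ∀ x a, |P.R θ x a - g x a| ≤ r), S.encard

/-- The Bradley-Terry preference oracle:
the label of `(x, a¹, a²)` is Bernoulli with mean `σ(R(θ_*, x, a¹) - R(θ_*, x, a²))`. -/
def label (P : PrefProblem X A Θ) : Kernel (X × A × A) Bool where
  toFun z :=
    ENNReal.ofReal (Real.sigmoid (P.R P.θstar z.1 z.2.1 - P.R P.θstar z.1 z.2.2)) •
        Measure.dirac true +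
      ENNReal.ofReal (1 - Real.sigmoid (P.R P.θstar z.1 z.2.1 - P.R P.θstar z.1 z.2.2)) •
        Measure.dirac false
  measurable' := by
    have h : Measurable fun z : X × A × A =>
        Real.sigmoid (P.R P.θstar z.1 z.2.1 - P.R P.θstar z.1 z.2.2) :=
      continuous_sigmoid.measurable.comp
        ((P.measurable_R.comp (f := fun z : X × A × A => (P.θstar, z.1, z.2.1)) (by fun_prop)).sub
          (P.measurable_R.comp (f := fun z : X × A × A => (P.θstar, z.1, z.2.2)) (by fun_prop)))
    refine Measure.measurable_of_measurable_coe _ fun s _ => ?_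
    simp only [Measure.coe_add, Measure.coe_smul, Pi.add_apply, Pi.smul_apply, smul_eq_mul]
    exact (h.ennreal_ofReal.mul_const _).add ((h.const_sub 1).ennreal_ofReal.mul_const _)

instance (P : PrefProblem X A Θ) : IsMarkovKernel P.label where
  isProbabilityMeasure z := by
    constructor
    simp only [label, Kernel.coe_mk, Measure.coe_add, Measure.coe_smul, Pi.add_apply,
      Pi.smul_apply, measure_univ, smul_eq_mul, mul_one]
    rw [← ENNReal.ofReal_add (Real.sigmoid_nonneg _)
      (sub_nonneg.2 (Real.sigmoid_lt_one _).le)]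
    simp

/-- The law of one observation when both actions are drawn independently from `π`: `x ∼ d₀`,
`a¹, a² ∼ π(·|x)`, and the label comes from the preference oracle. -/
def obsLaw (P : PrefProblem X A Θ) (π : Kernel X A) : Measure (Obs X A) :=
  (P.d₀ ⊗ₘ (π ×ₖ π)) ⊗ₘ P.label

instance (P : PrefProblem X A Θ) (π : Kernel X A) [IsMarkovKernel π] :
    IsProbabilityMeasure (P.obsLaw π) := by
  unfold obsLaw; infer_instance

theorem measurable_obsLaw_policy (P : PrefProblem X A Θ) :
    Measurable fun θ => P.obsLaw (P.policy θ) := by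
  have h : (fun θ => P.obsLaw (P.policy θ)) =
      ⇑((Kernel.const Θ P.d₀ ⊗ₖ (P.gibbs ×ₖ P.gibbs)) ⊗ₖ P.label.prodMkLeft Θ) := by
    funext θ
    rw [Kernel.compProd_apply_eq_compProd_sectR, Kernel.compProd_apply_eq_compProd_sectR,
      Kernel.const_apply]
    have h1 : (P.gibbs ×ₖ P.gibbs).sectR θ = P.policy θ ×ₖ P.policy θ := by
      ext x : 1
      simp [Kernel.prod_apply, policy]
    have h2 : (P.label.prodMkLeft Θ).sectR θ = P.label := by
      ext x : 1
      simp
    rw [h1, h2, obsLaw]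
  rw [h]
  exact Kernel.measurable _

/-- The law of the second-stage data given the first-stage data `D`: `n` independent observations
with actions drawn from `π_{θ̂₀(D)}^η`. -/
def secondStage (P : PrefProblem X A Θ) {m : ℕ} (n : ℕ) (est₀ : (Fin m → Obs X A) → Θ)
    (h₀ : Measurable est₀) : Kernel (Fin m → Obs X A) (Fin n → Obs X A) where
  toFun D := Measure.pi fun _ : Fin n => P.obsLaw (P.policy (est₀ D))
  measurable' := by
    refine Measurable.measure_of_isPiSystem_of_isProbabilityMeasure
      generateFrom_pi.symm isPiSystem_pi ?_
    rintro _ ⟨s, hs, rfl⟩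
    simp_rw [Measure.pi_pi]
    refine Finset.measurable_prod _ fun i _ => ?_
    exact (Measure.measurable_coe (show MeasurableSet (s i) from hs i (Set.mem_univ i))).comp
      (P.measurable_obsLaw_policy.comp h₀)

instance (P : PrefProblem X A Θ) {m : ℕ} (n : ℕ) (est₀ : (Fin m → Obs X A) → Θ)
    (h₀ : Measurable est₀) : IsMarkovKernel (P.secondStage n est₀ h₀) where
  isProbabilityMeasure D := by
    change IsProbabilityMeasure (Measure.pi fun _ : Fin n => P.obsLaw (P.policy (est₀ D)))
    infer_instance

/-- The law of all the data collected by the two-stage algorithm: `m` independent observations with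
actions from `π₀`, then `n` observations with actions from `π_{θ̂₀}^η`, where `θ̂₀` is computed
by `est₀` from the first-stage data. -/
def runLaw (P : PrefProblem X A Θ) (m n : ℕ) (est₀ : (Fin m → Obs X A) → Θ)
    (h₀ : Measurable est₀) : Measure ((Fin m → Obs X A) × (Fin n → Obs X A)) :=
  Measure.pi (fun _ : Fin m => P.obsLaw P.π₀) ⊗ₘ P.secondStage n est₀ h₀

/-- The log-likelihood of one observation in the Bradley-Terry model with reward `R θ`. -/
def logLik (P : PrefProblem X A Θ) (θ : Θ) (o : Obs X A) : ℝ :=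
  if o.2 then Real.log (Real.sigmoid (P.R θ o.1.1 o.1.2.1 - P.R θ o.1.1 o.1.2.2))
  else Real.log (Real.sigmoid (P.R θ o.1.1 o.1.2.2 - P.R θ o.1.1 o.1.2.1))

/-- `est₀` maximizes the likelihood of the first-stage data over `Θ`. -/
def IsFirstMLE (P : PrefProblem X A Θ) {m : ℕ} (est₀ : (Fin m → Obs X A) → Θ) : Prop :=
  ∀ D θ, ∑ i, P.logLik θ (D i) ≤ ∑ i, P.logLik (est₀ D) (D i)

/-- `est` maximizes the likelihood of the data of both stages together over `Θ`. -/
def IsFinalMLE (P : PrefProblem X A Θ) {m n : ℕ}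
    (est : (Fin m → Obs X A) × (Fin n → Obs X A) → Θ) : Prop :=
  ∀ D θ, ∑ i, P.logLik θ (D.1 i) + ∑ i, P.logLik θ (D.2 i) ≤
    ∑ i, P.logLik (est D) (D.1 i) + ∑ i, P.logLik (est D) (D.2 i)

/-- The sample size `C_ρ η / ε · e^B log (N_R(r) / δ)` with `ρ = 2 η B`. -/
def sampleSize (P : PrefProblem X A Θ) (ε δ r : ℝ) : ℝ :=
  (P.localCoverage (2 * P.η * P.B)).toReal * P.η / ε * Real.exp P.B *
    Real.log ((P.coveringNumber r).toNat / δ)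

end PrefProblem

end

/-!
By the Gibbs variational principle the suboptimality of `π_θ^η` is `η⁻¹` times the expected
divergence `KL(π_θ^η ‖ π^*)`. For Gibbs measures whose densities with respect to `π₀` are at most
`C`, the symmetrized divergence `E_{π₀} (q - p) (log q - log p)` is at most `C` times the
`π₀`-variance of `log q - log p`, because `(q - p)² ≤ C (q - p) (log q - log p)`. The suboptimality
is therefore linear in `C`, and quadratic in the error of the reward differences under `π₀`.

That error is controlled by the likelihood. The square root of the likelihood ratio of `θ` against
the truth has as its expectation the Hellinger affinity of two Bernoulli laws, which is at most
`exp (-err / (32 e^B))` for a query with squared reward-difference error `err`. Each first-stage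
observation contributes such a factor, and each second-stage observation a factor at most `1`,
whatever policy it was drawn with. Markov's inequality and a union bound over a finite cover
conclude, since the likelihood ratio of the maximum likelihood estimator is at least `1`.
-/

section LogisticFunction

open Real (exp log sigmoid cosh sinh)

theorem abs_log_sigmoid_sub_log_sigmoid_le (u v : ℝ) :
    |log (sigmoid u) - log (sigmoid v)| ≤ |u - v| := by
  have one_sided (s t : ℝ) : log (sigmoid s) - log (sigmoid t) ≤ |s - t| := by
    rw [← Real.log_div (Real.sigmoid_pos s).ne' (Real.sigmoid_pos t).ne',
      Real.log_le_iff_le_exp (div_pos (Real.sigmoid_pos s) (Real.sigmoid_pos t)),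
      Real.sigmoid_def, Real.sigmoid_def, inv_div_inv, div_le_iff₀ (by positivity), mul_add,
      ← Real.exp_add, mul_one]
    exact add_le_add (Real.one_le_exp (abs_nonneg _))
      (Real.exp_le_exp.2 (by linarith [le_abs_self (s - t)]))
  exact abs_sub_le_iff.2 ⟨one_sided u v, abs_sub_comm u v ▸ one_sided v u⟩

theorem sigmoid_eq_exp_div_cosh (u : ℝ) : sigmoid u = exp (u / 2) / (2 * cosh (u / 2)) := by
  have h : exp (-u) * exp (u / 2) = exp (-(u / 2)) := by rw [← Real.exp_add]; ring_nf
  rw [Real.sigmoid_def, inv_eq_one_div, div_eq_div_iff (by positivity) (by positivity),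
    Real.cosh_eq]
  linear_combination -h

theorem cosh_le_exp_abs (x : ℝ) : cosh x ≤ exp |x| := by
  rw [← Real.cosh_abs, Real.cosh_eq]
  linarith [Real.exp_le_exp.2 (neg_le_self (abs_nonneg x))]

theorem sq_le_sinh_sq (x : ℝ) : x ^ 2 ≤ sinh x ^ 2 := by
  rw [sq_le_sq, Real.abs_sinh]
  exact Real.self_le_sinh_iff.2 (abs_nonneg x)

/-- The Bhattacharyya coefficient `∑ √(p y * q y)` of the Bernoulli laws with means `p` and `q`,
that is, one minus half their squared Hellinger distance. -/
noncomputable def bernoulliAffinity (p q : ℝ) : ℝ := √(p * q) + √((1 - p) * (1 - q))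

theorem bernoulliAffinity_nonneg (p q : ℝ) : 0 ≤ bernoulliAffinity p q := by
  unfold bernoulliAffinity; positivity

theorem sqrt_sigmoid_mul_sigmoid (u v : ℝ) :
    √(sigmoid u * sigmoid v) = exp ((u + v) / 4) / (2 * √(cosh (u / 2) * cosh (v / 2))) := by
  have hexp : exp (u / 2) * exp (v / 2) = exp ((u + v) / 4) ^ 2 := by
    rw [← Real.exp_add, ← Real.exp_nat_mul]; congr 1; push_cast; ring
  rw [sigmoid_eq_exp_div_cosh, sigmoid_eq_exp_div_cosh, div_mul_div_comm, hexp, mul_mul_mul_comm,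
    Real.sqrt_div (sq_nonneg _), Real.sqrt_sq (Real.exp_pos _).le,
    Real.sqrt_mul (by norm_num), Real.sqrt_mul_self (by norm_num)]

theorem bernoulliAffinity_sigmoid (u v : ℝ) :
    bernoulliAffinity (sigmoid u) (sigmoid v) =
      cosh ((u + v) / 4) / √(cosh (u / 2) * cosh (v / 2)) := by
  rw [bernoulliAffinity, ← Real.sigmoid_neg, ← Real.sigmoid_neg, sqrt_sigmoid_mul_sigmoid,
    sqrt_sigmoid_mul_sigmoid, neg_div, neg_div, Real.cosh_neg, Real.cosh_neg, ← neg_add, neg_div,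
    ← add_div, Real.cosh_eq ((u + v) / 4), div_div]

theorem one_sub_bernoulliAffinity_sigmoid_sq (u v : ℝ) :
    1 - bernoulliAffinity (sigmoid u) (sigmoid v) ^ 2 =
      sinh ((u - v) / 4) ^ 2 / (cosh (u / 2) * cosh (v / 2)) := by
  have hu : u / 2 = (u + v) / 4 + (u - v) / 4 := by ring
  have hv : v / 2 = (u + v) / 4 - (u - v) / 4 := by ring
  have hcosh : cosh (u / 2) * cosh (v / 2) - cosh ((u + v) / 4) ^ 2 = sinh ((u - v) / 4) ^ 2 := by
    rw [hu, hv, Real.cosh_add, Real.cosh_sub]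
    linear_combination (cosh ((u + v) / 4) ^ 2) * Real.cosh_sq ((u - v) / 4) +
      (sinh ((u - v) / 4) ^ 2) * Real.cosh_sq ((u + v) / 4)
  rw [bernoulliAffinity_sigmoid, div_pow, Real.sq_sqrt (by positivity), one_sub_div (by positivity),
    hcosh]

theorem bernoulliAffinity_sigmoid_le {u v b : ℝ} (hu : |u| ≤ b) (hv : |v| ≤ b) :
    bernoulliAffinity (sigmoid u) (sigmoid v) ≤ 1 - (u - v) ^ 2 / (32 * exp b) := by
  have hcosh {x : ℝ} (hx : |x| ≤ b) : cosh (x / 2) ≤ exp (b / 2) := by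
    refine (cosh_le_exp_abs _).trans (Real.exp_le_exp.2 ?_)
    rw [abs_div, abs_two]
    linarith
  have hdenom : cosh (u / 2) * cosh (v / 2) ≤ exp b := by
    calc cosh (u / 2) * cosh (v / 2) ≤ exp (b / 2) * exp (b / 2) := by
          gcongr <;> exact hcosh ‹_›
      _ = exp b := by rw [← Real.exp_add, add_halves]
  have hdefect : (u - v) ^ 2 / (16 * exp b) ≤
      1 - bernoulliAffinity (sigmoid u) (sigmoid v) ^ 2 := by
    calc (u - v) ^ 2 / (16 * exp b) = ((u - v) / 4) ^ 2 / exp b := by field_simp; norm_num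
      _ ≤ sinh ((u - v) / 4) ^ 2 / (cosh (u / 2) * cosh (v / 2)) := by
          exact div_le_div₀ (sq_nonneg _) (sq_le_sinh_sq _) (by positivity) hdenom
      _ = _ := (one_sub_bernoulliAffinity_sigmoid_sq u v).symm
  have hhalf : (u - v) ^ 2 / (32 * exp b) = (u - v) ^ 2 / (16 * exp b) / 2 := by ring
  linarith [sq_nonneg (1 - bernoulliAffinity (sigmoid u) (sigmoid v))]

theorem mul_exp_half_log_sub_log {s t : ℝ} (hs : 0 < s) (ht : 0 < t) :
    t * exp ((log s - log t) / 2) = √(s * t) := by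
  rw [← Real.log_div hs.ne' ht.ne', ← Real.log_sqrt (by positivity),
    Real.exp_log (by positivity), Real.sqrt_div hs.le, Real.sqrt_mul hs.le]
  have := Real.mul_self_sqrt ht.le
  field_simp
  linarith

end LogisticFunction

theorem exists_finset_of_finite_cover {ι β : Type*} (near : ι → β → Prop) {S : Set β}
    (hfin : S.Finite) (hS : ∀ i, ∃ b ∈ S, near i b) :
    ∃ T : Finset ι, T.card ≤ S.encard.toNat ∧ ∀ i, ∃ j ∈ T, ∃ b, near i b ∧ near j b := by
  choose b hbS hb using hS
  obtain ⟨T, -, hT⟩ := (Set.univ : Set ι).exists_subset_bijOn b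
  have himage : b '' T ⊆ S := Set.image_subset_iff.2 fun i _ => hbS i
  have hTfin : T.Finite := (hfin.subset himage).of_finite_image hT.injOn
  refine ⟨hTfin.toFinset, ?_, fun i => ?_⟩
  · rw [← Set.ncard_eq_toFinset_card T hTfin, ← hT.injOn.ncard_image]
    exact Set.ncard_le_ncard himage hfin
  · obtain ⟨j, hj, hji⟩ := hT.surjOn (Set.mem_image_of_mem b (Set.mem_univ i))
    exact ⟨j, hTfin.mem_toFinset.2 hj, b i, hb i, hji ▸ hb j⟩

section Probability

variable {α β : Type*} [MeasurableSpace α] [MeasurableSpace β]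

theorem integrable_of_measurable_of_abs_le {μ : Measure α} [IsFiniteMeasure μ] {f : α → ℝ}
    (hf : Measurable f) {b : ℝ} (hb : ∀ a, |f a| ≤ b) : Integrable f μ :=
  Integrable.of_bound hf.aestronglyMeasurable (C := b) (ae_of_all _ hb)

theorem integrable_integral_kernel {μ : Measure α} [IsFiniteMeasure μ] {κ : Kernel α β}
    [IsMarkovKernel κ] {h : α × β → ℝ} (hm : Measurable h) {b : ℝ} (hb : ∀ z, |h z| ≤ b) :
    Integrable (fun x => ∫ y, h (x, y) ∂κ x) μ := by
  refine Integrable.of_bound (C := b)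
    hm.stronglyMeasurable.integral_kernel_prod_right'.aestronglyMeasurable (ae_of_all _ fun x => ?_)
  simpa using norm_integral_le_of_norm_le_const (μ := κ x) (f := fun y => h (x, y))
    (ae_of_all _ fun y => hb (x, y))

theorem lintegral_pi_exp_sum {ι : Type*} [Fintype ι] (μ : Measure α) [IsProbabilityMeasure μ]
    {f : α → ℝ} (hf : Measurable f) :
    ∫⁻ D : ι → α, ENNReal.ofReal (Real.exp (∑ i, f (D i))) ∂Measure.pi (fun _ => μ) =
      (∫⁻ a, ENNReal.ofReal (Real.exp (f a)) ∂μ) ^ Fintype.card ι := by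
  have hg : Measurable fun a => ENNReal.ofReal (Real.exp (f a)) := hf.exp.ennreal_ofReal
  have hindep : iIndepFun (fun (i : ι) (D : ι → α) => ENNReal.ofReal (Real.exp (f (D i))))
      (Measure.pi fun _ => μ) :=
    iIndepFun_pi (X := fun _ a => ENNReal.ofReal (Real.exp (f a))) fun _ => hg.aemeasurable
  calc ∫⁻ D : ι → α, ENNReal.ofReal (Real.exp (∑ i, f (D i))) ∂Measure.pi (fun _ => μ)
      = ∫⁻ D : ι → α, ∏ i, ENNReal.ofReal (Real.exp (f (D i))) ∂Measure.pi (fun _ => μ) := by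
        simp only [Real.exp_sum, ENNReal.ofReal_prod_of_nonneg fun _ _ => (Real.exp_pos _).le]
    _ = ∏ i, ∫⁻ D : ι → α, ENNReal.ofReal (Real.exp (f (D i))) ∂Measure.pi (fun _ => μ) :=
        lintegral_prod_eq_prod_lintegral_of_indepFun Finset.univ _ hindep
          fun i => hg.comp (measurable_pi_apply i)
    _ = ∏ _i : ι, ∫⁻ a, ENNReal.ofReal (Real.exp (f a)) ∂μ :=
        Finset.prod_congr rfl fun i _ =>
          (measurePreserving_eval (fun _ : ι => μ) i).lintegral_comp hg
    _ = _ := by rw [Finset.prod_const, Finset.card_univ]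

theorem lintegral_compProd_exp_add_le {μ : Measure α} [SFinite μ] {κ : Kernel α β}
    [IsSFiniteKernel κ] {f : α → ℝ} {g : β → ℝ} (hf : Measurable f) (hg : Measurable g)
    (hκ : ∀ a, ∫⁻ b, ENNReal.ofReal (Real.exp (g b)) ∂κ a ≤ 1) :
    ∫⁻ z, ENNReal.ofReal (Real.exp (f z.1 + g z.2)) ∂(μ ⊗ₘ κ) ≤
      ∫⁻ a, ENNReal.ofReal (Real.exp (f a)) ∂μ := by
  have hmeas : Measurable fun z : α × β => ENNReal.ofReal (Real.exp (f z.1 + g z.2)) := by fun_prop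
  rw [Measure.lintegral_compProd hmeas]
  refine lintegral_mono fun a => ?_
  simp only [Real.exp_add, ENNReal.ofReal_mul (Real.exp_pos _).le]
  rw [lintegral_const_mul _ hg.exp.ennreal_ofReal]
  exact mul_le_of_le_one_right' (hκ a)

theorem measure_sub_le_le_exp_neg_of_lintegral_exp_le {μ : Measure α} {f : α → ℝ}
    (hf : AEMeasurable f μ) {v : ℝ}
    (hv : ∫⁻ a, ENNReal.ofReal (Real.exp (f a)) ∂μ ≤ ENNReal.ofReal (Real.exp (-v))) (s : ℝ) :
    μ {a | s - v ≤ f a} ≤ ENNReal.ofReal (Real.exp (-s)) := by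
  calc μ {a | s - v ≤ f a}
      = μ {a | ENNReal.ofReal (Real.exp (s - v)) ≤ ENNReal.ofReal (Real.exp (f a))} := by
        simp only [ENNReal.ofReal_le_ofReal_iff (Real.exp_pos _).le, Real.exp_le_exp]
    _ ≤ (∫⁻ a, ENNReal.ofReal (Real.exp (f a)) ∂μ) / ENNReal.ofReal (Real.exp (s - v)) :=
        meas_ge_le_lintegral_div hf.exp.ennreal_ofReal
          (ENNReal.ofReal_pos.2 (Real.exp_pos _)).ne' ENNReal.ofReal_ne_top
    _ ≤ ENNReal.ofReal (Real.exp (-v)) / ENNReal.ofReal (Real.exp (s - v)) := by gcongr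
    _ = ENNReal.ofReal (Real.exp (-s)) := by
        rw [← ENNReal.ofReal_div_of_pos (Real.exp_pos _), ← Real.exp_sub]
        ring_nf

theorem ofReal_one_sub_le_measure_of_compl_subset_biUnion {ι : Type*} {μ : Measure α}
    [IsProbabilityMeasure μ] {good : Set α} {bad : ι → Set α} {T : Finset ι} {δ : ℝ} (hδ : 0 ≤ δ)
    (hsub : goodᶜ ⊆ ⋃ i ∈ T, bad i) (hbad : ∀ i ∈ T, μ (bad i) ≤ ENNReal.ofReal (δ / T.card)) :
    ENNReal.ofReal (1 - δ) ≤ μ good := by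
  have hunion : μ goodᶜ ≤ ENNReal.ofReal δ := by
    calc μ goodᶜ ≤ ∑ i ∈ T, μ (bad i) := (measure_mono hsub).trans (measure_biUnion_finset_le T bad)
      _ ≤ ∑ _i ∈ T, ENNReal.ofReal (δ / T.card) := Finset.sum_le_sum hbad
      _ = ENNReal.ofReal (T.card * (δ / T.card)) := by
          rw [Finset.sum_const, nsmul_eq_mul, ENNReal.ofReal_mul (Nat.cast_nonneg _),
            ENNReal.ofReal_natCast]
      _ ≤ ENNReal.ofReal δ := by
          rw [mul_div_left_comm]
          exact ENNReal.ofReal_le_ofReal (mul_le_of_le_one_right hδ (div_self_le_one _))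
  rw [ENNReal.ofReal_sub _ hδ, ENNReal.ofReal_one, tsub_le_iff_right, ← measure_univ (μ := μ)]
  exact (measure_univ_le_add_compl good).trans (by gcongr)

theorem log_real_singleton_div_ae_eq_llr [Countable α] [MeasurableSingletonClass α]
    {μ ν : Measure α} [IsFiniteMeasure μ] [SigmaFinite ν] (hμν : μ ≪ ν) :
    (fun a => Real.log (μ.real {a} / ν.real {a})) =ᵐ[μ] llr μ ν := by
  refine ae_iff_of_countable.2 fun a ha => ?_
  have hνa : ν {a} ≠ 0 := fun h => ha (hμν h)
  have hmass : μ {a} = μ.rnDeriv ν a * ν {a} := by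
    rw [← Measure.setLIntegral_rnDeriv hμν, lintegral_singleton]
  simp only [llr, Measure.real]
  rw [hmass, ENNReal.toReal_mul, mul_div_cancel_right₀]
  exact ENNReal.toReal_ne_zero.2 ⟨hνa, (measure_singleton_lt_top).ne⟩

theorem integral_prod_sub_sq_eq_two_mul_variance {μ : Measure α} [IsProbabilityMeasure μ]
    {f : α → ℝ} (hf : MemLp f 2 μ) :
    ∫ z : α × α, (f z.1 - f z.2) ^ 2 ∂(μ.prod μ) = 2 * Var[f; μ] := by
  have hsq : Integrable (fun z => f z ^ 2) μ := hf.integrable_sq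
  have hint : Integrable f μ := hf.integrable one_le_two
  have hprod : Integrable (fun z : α × α => 2 * (f z.1 * f z.2)) (μ.prod μ) :=
    (hint.mul_prod hint).const_mul 2
  have hdiff : Integrable (fun z : α × α => f z.1 ^ 2 - 2 * (f z.1 * f z.2)) (μ.prod μ) :=
    (hsq.comp_fst μ).sub hprod
  simp only [sub_sq, mul_assoc]
  rw [integral_add hdiff (hsq.comp_snd μ),
    integral_sub (hsq.comp_fst μ) hprod, integral_const_mul, integral_prod_mul,
    integral_fun_fst (fun a => f a ^ 2), integral_fun_snd (fun a => f a ^ 2), variance_eq_sub hf]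
  simp only [probReal_univ, one_smul, Pi.pow_apply]
  ring

end Probability

section GibbsMeasure

open InformationTheory

variable {α : Type*} [MeasurableSpace α] {μ ν : Measure α} {f g : α → ℝ}

theorem integral_sub_toReal_klDiv_eq_log_integral_exp_sub [IsProbabilityMeasure μ]
    [IsProbabilityMeasure ν] (hkl : klDiv μ ν ≠ ⊤) (hf : Integrable f μ)
    (hexp : Integrable (fun a => Real.exp (f a)) ν) :
    ∫ a, f a ∂μ - (klDiv μ ν).toReal =
      Real.log (∫ a, Real.exp (f a) ∂ν) - (klDiv μ (ν.tilted f)).toReal := by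
  obtain ⟨hμν, hllr⟩ := klDiv_ne_top_iff.1 hkl
  have := isProbabilityMeasure_tilted hexp
  rw [toReal_klDiv_of_measure_eq hμν (by simp),
    toReal_klDiv_of_measure_eq (hμν.trans (absolutelyContinuous_tilted hexp)) (by simp),
    integral_llr_tilted_right hμν hf hexp hllr]
  ring

theorem klDiv_tilted_self_ne_top [IsProbabilityMeasure μ]
    (hexp : Integrable (fun a => Real.exp (f a)) μ) (hf : Integrable f (μ.tilted f)) :
    klDiv (μ.tilted f) μ ≠ ⊤ := by
  have := isProbabilityMeasure_tilted hexp
  have hac := tilted_absolutelyContinuous μ f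
  refine klDiv_ne_top hac ((integrable_congr (hac.ae_le (log_rnDeriv_tilted_left_self hexp))).2 ?_)
  exact hf.sub (integrable_const _)

theorem toReal_klDiv_tilted_add_toReal_klDiv_tilted [IsProbabilityMeasure μ]
    (hexp : Integrable (fun a => Real.exp (f a)) μ) (hf : Integrable f μ)
    (hf' : Integrable f (μ.tilted f)) :
    (klDiv (μ.tilted f) μ).toReal + (klDiv μ (μ.tilted f)).toReal =
      ∫ a, f a ∂(μ.tilted f) - ∫ a, f a ∂μ := by
  have := isProbabilityMeasure_tilted hexp
  have h₁ := integral_sub_toReal_klDiv_eq_log_integral_exp_sub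
    (klDiv_tilted_self_ne_top hexp hf') hf' hexp
  have h₂ := integral_sub_toReal_klDiv_eq_log_integral_exp_sub (by simp) hf hexp
  rw [klDiv_self, ENNReal.toReal_zero] at h₁ h₂
  linarith

theorem klDiv_tilted_self_le [IsProbabilityMeasure μ] (hf : Measurable f) {b c : ℝ}
    (hb : ∀ a, b ≤ f a) (hc : ∀ a, f a ≤ c) :
    klDiv (μ.tilted f) μ ≤ ENNReal.ofReal (c - b) := by
  have hint (ξ : Measure α) [IsFiniteMeasure ξ] : Integrable f ξ :=
    integrable_of_measurable_of_abs_le hf fun a => abs_le_max_abs_abs (hb a) (hc a)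
  have hexp : Integrable (fun a => Real.exp (f a)) μ :=
    integrable_of_measurable_of_abs_le hf.exp (b := Real.exp c) fun a => by
      rw [Real.abs_exp]; exact Real.exp_le_exp.2 (hc a)
  have := isProbabilityMeasure_tilted hexp
  have hupper : ∫ a, f a ∂(μ.tilted f) ≤ c := by
    simpa using integral_mono (hint (μ.tilted f)) (integrable_const c) hc
  have hlower : b ≤ ∫ a, f a ∂μ := by
    simpa using integral_mono (integrable_const b) (hint μ) hb
  have hjeffreys := toReal_klDiv_tilted_add_toReal_klDiv_tilted hexp (hint μ) (hint _)
  have hreverse : 0 ≤ (klDiv μ (μ.tilted f)).toReal := ENNReal.toReal_nonneg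
  refine ENNReal.le_ofReal_iff_toReal_le (klDiv_tilted_self_ne_top hexp (hint _)) ?_ |>.2 ?_
  · linarith [ENNReal.toReal_nonneg (a := klDiv (μ.tilted f) μ)]
  · linarith

theorem sq_sub_le_mul_sub_mul_log_sub {p q C : ℝ} (hp : 0 < p) (hq : 0 < q) (hpC : p ≤ C)
    (hqC : q ≤ C) :
    (q - p) ^ 2 ≤ C * ((q - p) * (Real.log q - Real.log p)) := by
  wlog hpq : p ≤ q generalizing p q
  · linarith [this hq hp hqC hpC (le_of_not_ge hpq)]
  have hlog : q - p ≤ q * (Real.log q - Real.log p) := by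
    have h := Real.one_sub_inv_le_log_of_pos (div_pos hq hp)
    rw [Real.log_div hq.ne' hp.ne', inv_div] at h
    calc q - p = q * (1 - p / q) := by field_simp
      _ ≤ _ := by gcongr
  have hlogC : q * (Real.log q - Real.log p) ≤ C * (Real.log q - Real.log p) :=
    mul_le_mul_of_nonneg_right hqC (sub_nonneg.2 (Real.log_le_log hp hpq))
  nlinarith [mul_le_mul_of_nonneg_left (hlog.trans hlogC) (sub_nonneg.2 hpq)]

theorem two_mul_sub_mul_le {p q C : ℝ} (hp : 0 < p) (hq : 0 < q) (hpC : p ≤ C) (hqC : q ≤ C)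
    (h : ℝ) :
    2 * ((q - p) * h) ≤ (q - p) * (Real.log q - Real.log p) + C * h ^ 2 := by
  have hC : 0 < C := hp.trans_le hpC
  calc 2 * ((q - p) * h) ≤ (q - p) ^ 2 / C + C * h ^ 2 := by
        have hsq : (q - p) ^ 2 / C + C * h ^ 2 - 2 * ((q - p) * h) = (q - p - C * h) ^ 2 / C := by
          field_simp
          ring
        linarith [div_nonneg (sq_nonneg (q - p - C * h)) hC.le]
    _ ≤ _ := by
        gcongr
        exact (div_le_iff₀' hC).2 (sq_sub_le_mul_sub_mul_log_sub hp hq hpC hqC)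

theorem integral_sub_mul_le_mul_variance [IsProbabilityMeasure ν] {p q h : α → ℝ} {C k : ℝ}
    (hp : Integrable p ν) (hq : Integrable q ν) (hp₀ : ∀ a, 0 < p a) (hq₀ : ∀ a, 0 < q a)
    (hpC : ∀ᵐ a ∂ν, p a ≤ C) (hqC : ∀ᵐ a ∂ν, q a ≤ C) (hmass : ∫ a, p a ∂ν = ∫ a, q a ∂ν)
    (hlog : ∀ a, Real.log (q a) - Real.log (p a) = h a + k) (hh : MemLp h 2 ν) :
    ∫ a, (q a - p a) * h a ∂ν ≤ C * Var[h; ν] := by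
  set c := ∫ a, h a ∂ν with hc
  have hint : Integrable h ν := hh.integrable one_le_two
  have hdiff : Integrable (fun a => q a - p a) ν := hq.sub hp
  have hmul : Integrable (fun a => (q a - p a) * h a) ν := by
    refine hint.bdd_mul (c := C) hdiff.aestronglyMeasurable ?_
    filter_upwards [hpC, hqC] with a hpa hqa
    rw [Real.norm_eq_abs, abs_le]
    constructor <;> linarith [hp₀ a, hq₀ a]
  have hshift (t : ℝ) : Integrable (fun a => (q a - p a) * (h a + t)) ν ∧
      ∫ a, (q a - p a) * (h a + t) ∂ν = ∫ a, (q a - p a) * h a ∂ν := by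
    simp only [mul_add]
    refine ⟨hmul.add (hdiff.mul_const t), ?_⟩
    rw [integral_add hmul (hdiff.mul_const t), integral_mul_const, integral_sub hq hp, hmass]
    ring
  have hsq : Integrable (fun a => C * (h a + -c) ^ 2) ν :=
    (hh.add (memLp_const (-c))).integrable_sq.const_mul C
  have hyoung : ∫ a, 2 * ((q a - p a) * (h a + -c)) ∂ν ≤
      ∫ a, ((q a - p a) * (h a + k) + C * (h a + -c) ^ 2) ∂ν := by
    refine integral_mono_ae ((hshift _).1.const_mul 2) ((hshift k).1.add hsq) ?_
    filter_upwards [hpC, hqC] with a hpa hqa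
    rw [← hlog a]
    exact two_mul_sub_mul_le (hp₀ a) (hq₀ a) hpa hqa _
  rw [integral_const_mul, integral_add (hshift k).1 hsq, (hshift _).2, (hshift k).2,
    integral_const_mul] at hyoung
  rw [variance_eq_integral hint.aemeasurable, ← hc]
  simp only [sub_eq_add_neg (h _)]
  linarith

theorem integrable_tilted_of_density_le [NeZero ν] {C : ℝ}
    (hf : Integrable (fun a => Real.exp (f a)) ν)
    (hC : ∀ᵐ a ∂ν, Real.exp (f a) / ∫ a, Real.exp (f a) ∂ν ≤ C) (hg : Integrable g ν) :
    Integrable g (ν.tilted f) := by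
  refine (integrable_tilted_iff hf g).2 (hg.bdd_mul hf.aestronglyMeasurable
    (c := C * ∫ a, Real.exp (f a) ∂ν) ?_)
  filter_upwards [hC] with a ha
  rwa [Real.norm_eq_abs, Real.abs_exp, ← div_le_iff₀ (integral_exp_pos hf)]

theorem toReal_klDiv_tilted_tilted_le_integral_sub [IsProbabilityMeasure ν]
    (hf : Integrable (fun a => Real.exp (f a)) ν) (hg : Integrable (fun a => Real.exp (g a)) ν)
    (hfg : Integrable (f - g) (ν.tilted f)) (hgf : Integrable (f - g) (ν.tilted g)) :
    (klDiv (ν.tilted f) (ν.tilted g)).toReal ≤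
      ∫ a, (f - g) a ∂(ν.tilted f) - ∫ a, (f - g) a ∂(ν.tilted g) := by
  have := isProbabilityMeasure_tilted hg
  have htilt : (ν.tilted g).tilted (f - g) = ν.tilted f := by
    rw [tilted_tilted hg, add_sub_cancel]
  have hexp : Integrable (fun a => Real.exp ((f - g) a)) (ν.tilted g) := by
    refine (integrable_tilted_iff hg _).2 (hf.congr (ae_of_all _ fun a => ?_))
    simp [← Real.exp_add]
  have hjeffreys := toReal_klDiv_tilted_add_toReal_klDiv_tilted hexp hgf (htilt ▸ hfg)
  rw [htilt] at hjeffreys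
  linarith [ENNReal.toReal_nonneg (a := klDiv (ν.tilted g) (ν.tilted f))]

theorem toReal_klDiv_tilted_tilted_le_mul_variance [IsProbabilityMeasure ν] {C : ℝ}
    (hf : Integrable (fun a => Real.exp (f a)) ν) (hg : Integrable (fun a => Real.exp (g a)) ν)
    (hfg : MemLp (f - g) 2 ν)
    (hfC : ∀ᵐ a ∂ν, Real.exp (f a) / ∫ a, Real.exp (f a) ∂ν ≤ C)
    (hgC : ∀ᵐ a ∂ν, Real.exp (g a) / ∫ a, Real.exp (g a) ∂ν ≤ C) :
    (klDiv (ν.tilted f) (ν.tilted g)).toReal ≤ C * Var[f - g; ν] := by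
  have hZf := integral_exp_pos hf
  have hZg := integral_exp_pos hg
  have hint : Integrable (f - g) ν := hfg.integrable one_le_two
  have hintf := integrable_tilted_of_density_le hf hfC hint
  have hintg := integrable_tilted_of_density_le hg hgC hint
  have hlog (a : α) : Real.log (Real.exp (f a) / ∫ a, Real.exp (f a) ∂ν) -
      Real.log (Real.exp (g a) / ∫ a, Real.exp (g a) ∂ν) = (f - g) a +
        (Real.log (∫ a, Real.exp (g a) ∂ν) - Real.log (∫ a, Real.exp (f a) ∂ν)) := by
    rw [Real.log_div (Real.exp_ne_zero _) hZf.ne', Real.log_div (Real.exp_ne_zero _) hZg.ne',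
      Real.log_exp, Real.log_exp, Pi.sub_apply]
    ring
  have hmass : ∫ a, Real.exp (g a) / ∫ a, Real.exp (g a) ∂ν ∂ν =
      ∫ a, Real.exp (f a) / ∫ a, Real.exp (f a) ∂ν ∂ν := by
    rw [integral_div, integral_div, div_self hZf.ne', div_self hZg.ne']
  refine (toReal_klDiv_tilted_tilted_le_integral_sub hf hg hintf hintg).trans ?_
  have hdensf := (integrable_tilted_iff hf _).1 hintf
  have hdensg := (integrable_tilted_iff hg _).1 hintg
  have hvar := integral_sub_mul_le_mul_variance (hg.div_const _) (hf.div_const _)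
    (fun a => div_pos (Real.exp_pos _) hZg) (fun a => div_pos (Real.exp_pos _) hZf) hgC hfC hmass
    hlog hfg
  refine Eq.trans_le ?_ hvar
  rw [integral_tilted, integral_tilted, ← integral_sub]
  · simp only [smul_eq_mul, sub_mul]
  · simpa only [smul_eq_mul, div_mul_eq_mul_div] using hdensf.div_const _
  · simpa only [smul_eq_mul, div_mul_eq_mul_div] using hdensg.div_const _

theorem toReal_klDiv_tilted_tilted [IsProbabilityMeasure ν]
    (hf : Integrable (fun a => Real.exp (f a)) ν) (hg : Integrable (fun a => Real.exp (g a)) ν)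
    (hf' : Integrable f (ν.tilted f)) (hg' : Integrable g (ν.tilted f)) :
    (klDiv (ν.tilted f) (ν.tilted g)).toReal = ∫ a, (f a - g a) ∂(ν.tilted f) -
      (Real.log (∫ a, Real.exp (f a) ∂ν) - Real.log (∫ a, Real.exp (g a) ∂ν)) := by
  have := isProbabilityMeasure_tilted hf
  have hkl := klDiv_tilted_self_ne_top hf hf'
  have hself := integral_sub_toReal_klDiv_eq_log_integral_exp_sub hkl hf' hf
  have hother := integral_sub_toReal_klDiv_eq_log_integral_exp_sub hkl hg' hg
  rw [klDiv_self, ENNReal.toReal_zero] at hself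
  rw [integral_sub hf' hg']
  linarith

theorem tilted_real_singleton [MeasurableSingletonClass α] [SFinite ν] (f : α → ℝ) (a : α) :
    (ν.tilted f).real {a} =
      Real.exp (f a) / (∫ b, Real.exp (f b) ∂ν) * ν.real {a} := by
  rw [Measure.real, tilted_apply, lintegral_singleton, ENNReal.toReal_mul,
    ENNReal.toReal_ofReal (by positivity), Measure.real]

end GibbsMeasure

namespace PrefProblem

variable {X A Θ : Type*} [MeasurableSpace X] [MeasurableSpace A] [MeasurableSpace Θ]
  (P : PrefProblem X A Θ) {m n : ℕ}

/-! ### Concentration of the likelihood ratio -/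

/-- The reward difference of the two actions of a query `(x, a¹, a²)`: the logit of the
preference probability under the reward `R θ`. -/
noncomputable def margin (θ : Θ) (z : X × A × A) : ℝ :=
  P.R θ z.1 z.2.1 - P.R θ z.1 z.2.2

/-- The mean squared error of the margins of `θ` when both actions are drawn from `π`. -/
noncomputable def marginError (π : Kernel X A) (θ : Θ) : ℝ :=
  ∫ z, (P.margin θ z - P.margin P.θstar z) ^ 2 ∂(P.d₀ ⊗ₘ (π ×ₖ π))

/-- The log-likelihood ratio of `θ` against the true parameter for one observation. -/
noncomputable def logRatio (θ : Θ) (o : Obs X A) : ℝ :=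
  P.logLik θ o - P.logLik P.θstar o

/-- The log-likelihood ratio of `θ` against the true parameter for the data of both stages. -/
noncomputable def totalLogRatio (θ : Θ) (D : (Fin m → Obs X A) × (Fin n → Obs X A)) : ℝ :=
  ∑ i, P.logRatio θ (D.1 i) + ∑ i, P.logRatio θ (D.2 i)

theorem measurable_R_apply (θ : Θ) : Measurable fun p : X × A => P.R θ p.1 p.2 :=
  P.measurable_R.comp (f := fun p : X × A => (θ, p.1, p.2)) (by fun_prop)

theorem measurable_R_apply_apply (θ : Θ) (x : X) : Measurable (P.R θ x) :=
  (P.measurable_R_apply θ).comp measurable_prodMk_left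

theorem abs_R_le (θ : Θ) (x : X) (a : A) : |P.R θ x a| ≤ P.B := by
  rw [abs_of_nonneg (P.R_nonneg θ x a)]
  exact P.R_le θ x a

theorem measurable_margin (θ : Θ) : Measurable (P.margin θ) :=
  ((P.measurable_R_apply θ).comp (f := fun z : X × A × A => (z.1, z.2.1)) (by fun_prop)).sub
    ((P.measurable_R_apply θ).comp (f := fun z : X × A × A => (z.1, z.2.2)) (by fun_prop))

theorem abs_margin_le (θ : Θ) (z : X × A × A) : |P.margin θ z| ≤ P.B :=
  abs_sub_le_of_nonneg_of_le (P.R_nonneg _ _ _) (P.R_le _ _ _) (P.R_nonneg _ _ _) (P.R_le _ _ _)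

theorem measurable_sq_margin_sub_margin (θ θ' : Θ) :
    Measurable fun z => (P.margin θ z - P.margin θ' z) ^ 2 :=
  ((P.measurable_margin θ).sub (P.measurable_margin θ')).pow_const 2

theorem abs_sq_margin_sub_margin_le (θ θ' : Θ) (z : X × A × A) :
    |(P.margin θ z - P.margin θ' z) ^ 2| ≤ (2 * P.B) ^ 2 := by
  rw [abs_pow]
  gcongr
  linarith [abs_sub (P.margin θ z) (P.margin θ' z), P.abs_margin_le θ z, P.abs_margin_le θ' z]

theorem integrable_sq_margin_sub_margin (μ : Measure (X × A × A)) [IsFiniteMeasure μ]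
    (θ θ' : Θ) : Integrable (fun z => (P.margin θ z - P.margin θ' z) ^ 2) μ :=
  integrable_of_measurable_of_abs_le (P.measurable_sq_margin_sub_margin θ θ')
    (P.abs_sq_margin_sub_margin_le θ θ')

theorem marginError_nonneg (π : Kernel X A) (θ : Θ) : 0 ≤ P.marginError π θ :=
  integral_nonneg fun _ => sq_nonneg _

theorem logLik_eq (θ : Θ) (o : Obs X A) :
    P.logLik θ o = if o.2 then Real.log (Real.sigmoid (P.margin θ o.1))
      else Real.log (Real.sigmoid (-P.margin θ o.1)) := by
  simp only [logLik, margin, neg_sub]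

theorem abs_logLik_sub_logLik_le (θ θ' : Θ) (o : Obs X A) :
    |P.logLik θ o - P.logLik θ' o| ≤ |P.margin θ o.1 - P.margin θ' o.1| := by
  rw [logLik_eq, logLik_eq]
  split_ifs
  · exact abs_log_sigmoid_sub_log_sigmoid_le _ _
  · rw [← abs_neg (P.margin θ o.1 - _), neg_sub', sub_neg_eq_add, ← sub_neg_eq_add]
    exact abs_log_sigmoid_sub_log_sigmoid_le _ _

theorem measurable_logLik (θ : Θ) : Measurable (P.logLik θ) := by
  have hmargin : Measurable fun o : Obs X A => P.margin θ o.1 :=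
    (P.measurable_margin θ).comp measurable_fst
  rw [funext (P.logLik_eq θ)]
  refine Measurable.ite (measurable_snd (measurableSet_singleton true)) ?_ ?_
  · exact (continuous_sigmoid.measurable.comp hmargin).log
  · exact (continuous_sigmoid.measurable.comp hmargin.neg).log

theorem measurable_logRatio (θ : Θ) : Measurable (P.logRatio θ) :=
  (P.measurable_logLik θ).sub (P.measurable_logLik P.θstar)

theorem measurable_sum_logRatio (θ : Θ) (k : ℕ) :
    Measurable fun D : Fin k → Obs X A => ∑ i, P.logRatio θ (D i) :=
  Finset.measurable_sum _ fun i _ => (P.measurable_logRatio θ).comp (measurable_pi_apply i)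

theorem measurable_totalLogRatio (θ : Θ) : Measurable (P.totalLogRatio θ (m := m) (n := n)) :=
  ((P.measurable_sum_logRatio θ m).comp measurable_fst).add
    ((P.measurable_sum_logRatio θ n).comp measurable_snd)

theorem lintegral_label_exp_half_logRatio (θ : Θ) (z : X × A × A) :
    ∫⁻ y, ENNReal.ofReal (Real.exp (P.logRatio θ (z, y) / 2)) ∂P.label z =
      ENNReal.ofReal (bernoulliAffinity (Real.sigmoid (P.margin θ z))
        (Real.sigmoid (P.margin P.θstar z))) := by
  have hlabel : P.label z =
      ENNReal.ofReal (Real.sigmoid (P.margin P.θstar z)) • Measure.dirac true +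
        ENNReal.ofReal (Real.sigmoid (-P.margin P.θstar z)) • Measure.dirac false := by
    rw [Real.sigmoid_neg]; rfl
  rw [hlabel, lintegral_add_measure, lintegral_smul_measure, lintegral_smul_measure,
    lintegral_dirac, lintegral_dirac, smul_eq_mul, smul_eq_mul,
    ← ENNReal.ofReal_mul (Real.sigmoid_nonneg _), ← ENNReal.ofReal_mul (Real.sigmoid_nonneg _),
    ← ENNReal.ofReal_add (mul_nonneg (Real.sigmoid_nonneg _) (Real.exp_pos _).le)
      (mul_nonneg (Real.sigmoid_nonneg _) (Real.exp_pos _).le)]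
  simp only [logRatio, logLik_eq, if_true, Bool.false_eq_true, if_false]
  rw [mul_exp_half_log_sub_log (Real.sigmoid_pos _) (Real.sigmoid_pos _),
    mul_exp_half_log_sub_log (Real.sigmoid_pos _) (Real.sigmoid_pos _), bernoulliAffinity,
    Real.sigmoid_neg, Real.sigmoid_neg]

theorem lintegral_obsLaw_exp_half_logRatio_le (π : Kernel X A) [IsMarkovKernel π] (θ : Θ) :
    ∫⁻ o, ENNReal.ofReal (Real.exp (P.logRatio θ o / 2)) ∂P.obsLaw π ≤
      ENNReal.ofReal (Real.exp (-(P.marginError π θ / (32 * Real.exp P.B)))) := by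
  have haffinity (z : X × A × A) :
      bernoulliAffinity (Real.sigmoid (P.margin θ z)) (Real.sigmoid (P.margin P.θstar z)) ≤
        1 - (P.margin θ z - P.margin P.θstar z) ^ 2 / (32 * Real.exp P.B) :=
    bernoulliAffinity_sigmoid_le (P.abs_margin_le θ z) (P.abs_margin_le P.θstar z)
  have hint := (P.integrable_sq_margin_sub_margin (P.d₀ ⊗ₘ (π ×ₖ π)) θ P.θstar).div_const
    (32 * Real.exp P.B)
  have hint' : Integrable (fun z => 1 - (P.margin θ z - P.margin P.θstar z) ^ 2 /
      (32 * Real.exp P.B)) (P.d₀ ⊗ₘ (π ×ₖ π)) := (integrable_const 1).sub hint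
  calc ∫⁻ o, ENNReal.ofReal (Real.exp (P.logRatio θ o / 2)) ∂P.obsLaw π
      = ∫⁻ z, ENNReal.ofReal (bernoulliAffinity (Real.sigmoid (P.margin θ z))
          (Real.sigmoid (P.margin P.θstar z))) ∂(P.d₀ ⊗ₘ (π ×ₖ π)) := by
        rw [obsLaw, Measure.lintegral_compProd
          ((P.measurable_logRatio θ).div_const 2).exp.ennreal_ofReal]
        simp only [lintegral_label_exp_half_logRatio]
    _ ≤ ∫⁻ z, ENNReal.ofReal (1 - (P.margin θ z - P.margin P.θstar z) ^ 2 /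
          (32 * Real.exp P.B)) ∂(P.d₀ ⊗ₘ (π ×ₖ π)) :=
        lintegral_mono fun z => ENNReal.ofReal_le_ofReal (haffinity z)
    _ = ENNReal.ofReal (1 - P.marginError π θ / (32 * Real.exp P.B)) := by
        rw [← ofReal_integral_eq_lintegral_ofReal hint'
          (ae_of_all _ fun z => (bernoulliAffinity_nonneg _ _).trans (haffinity z)),
          integral_sub (integrable_const 1) hint, integral_div, integral_const, probReal_univ,
          one_smul, marginError]
    _ ≤ _ := ENNReal.ofReal_le_ofReal (Real.one_sub_le_exp_neg _)

theorem lintegral_pi_obsLaw_exp_half_sum_logRatio_le (π : Kernel X A) [IsMarkovKernel π]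
    (θ : Θ) (k : ℕ) :
    ∫⁻ D : Fin k → Obs X A, ENNReal.ofReal (Real.exp ((∑ i, P.logRatio θ (D i)) / 2))
        ∂Measure.pi (fun _ => P.obsLaw π) ≤
      ENNReal.ofReal (Real.exp (-(k * (P.marginError π θ / (32 * Real.exp P.B))))) := by
  simp only [Finset.sum_div]
  rw [lintegral_pi_exp_sum _ ((P.measurable_logRatio θ).div_const 2), Fintype.card_fin,
    ← mul_neg, Real.exp_nat_mul, ENNReal.ofReal_pow (Real.exp_pos _).le]
  exact pow_le_pow_left' (P.lintegral_obsLaw_exp_half_logRatio_le π θ) k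

theorem lintegral_runLaw_exp_half_totalLogRatio_le (est₀ : (Fin m → Obs X A) → Θ)
    (h₀ : Measurable est₀) (θ : Θ) :
    ∫⁻ D, ENNReal.ofReal (Real.exp (P.totalLogRatio θ D / 2)) ∂P.runLaw m n est₀ h₀ ≤
      ENNReal.ofReal (Real.exp (-(m * (P.marginError P.π₀ θ / (32 * Real.exp P.B))))) := by
  simp only [totalLogRatio, add_div]
  refine (lintegral_compProd_exp_add_le ((P.measurable_sum_logRatio θ m).div_const 2)
    ((P.measurable_sum_logRatio θ n).div_const 2) fun D => ?_).trans
    (P.lintegral_pi_obsLaw_exp_half_sum_logRatio_le P.π₀ θ m)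
  refine (P.lintegral_pi_obsLaw_exp_half_sum_logRatio_le (P.policy (est₀ D)) θ n).trans ?_
  have := P.marginError_nonneg (P.policy (est₀ D)) θ
  rw [ENNReal.ofReal_le_one, Real.exp_le_one_iff, neg_nonpos]
  positivity

theorem runLaw_sub_le_half_totalLogRatio_le (est₀ : (Fin m → Obs X A) → Θ)
    (h₀ : Measurable est₀) (θ : Θ) (s : ℝ) :
    P.runLaw m n est₀ h₀ {D | s - m * (P.marginError P.π₀ θ / (32 * Real.exp P.B)) ≤
      P.totalLogRatio θ D / 2} ≤ ENNReal.ofReal (Real.exp (-s)) :=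
  measure_sub_le_le_exp_neg_of_lintegral_exp_le
    ((P.measurable_totalLogRatio θ).div_const 2).aemeasurable
    (P.lintegral_runLaw_exp_half_totalLogRatio_le est₀ h₀ θ) s

/-! ### Maximum likelihood over a cover -/

theorem exists_cover_encard_eq_coveringNumber {r : ℝ} (hN : P.coveringNumber r ≠ ⊤) :
    ∃ S : Set (X → A → ℝ), (∀ θ, ∃ g ∈ S, ∀ x a, |P.R θ x a - g x a| ≤ r) ∧
      S.encard = P.coveringNumber r := by
  rw [coveringNumber, iInf_subtype'] at hN ⊢
  have : Nonempty {S : Set (X → A → ℝ) // ∀ θ, ∃ g ∈ S, ∀ x a, |P.R θ x a - g x a| ≤ r} :=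
    not_isEmpty_iff.1 fun _ => hN (iInf_of_empty _)
  obtain ⟨S, hS⟩ := ciInf_mem fun S : {S : Set (X → A → ℝ) //
    ∀ θ, ∃ g ∈ S, ∀ x a, |P.R θ x a - g x a| ≤ r} => S.1.encard
  exact ⟨S.1, S.2, hS⟩

theorem exists_finset_cover {r : ℝ} (hN : P.coveringNumber r ≠ ⊤) :
    ∃ T : Finset Θ, T.card ≤ (P.coveringNumber r).toNat ∧
      ∀ θ, ∃ θ' ∈ T, ∀ x a, |P.R θ x a - P.R θ' x a| ≤ 2 * r := by
  obtain ⟨S, hS, hcard⟩ := P.exists_cover_encard_eq_coveringNumber hN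
  have hfin : S.Finite := Set.encard_ne_top_iff.1 (hcard ▸ hN)
  obtain ⟨T, hT, hcover⟩ := exists_finset_of_finite_cover
    (fun θ g => ∀ x a, |P.R θ x a - g x a| ≤ r) hfin hS
  refine ⟨T, by rwa [← hcard], fun θ => ?_⟩
  obtain ⟨θ', hθ', g, hθg, hθ'g⟩ := hcover θ
  refine ⟨θ', hθ', fun x a => ?_⟩
  calc |P.R θ x a - P.R θ' x a| ≤ |P.R θ x a - g x a| + |g x a - P.R θ' x a| :=
        abs_sub_le _ _ _
    _ ≤ r + r := add_le_add (hθg x a) (abs_sub_comm (g x a) _ ▸ hθ'g x a)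
    _ = 2 * r := (two_mul r).symm

theorem one_le_toNat_coveringNumber {r : ℝ} (hN : P.coveringNumber r ≠ ⊤) :
    1 ≤ (P.coveringNumber r).toNat := by
  obtain ⟨T, hcard, hT⟩ := P.exists_finset_cover hN
  obtain ⟨θ, hθ, -⟩ := hT P.θstar
  exact (Finset.card_pos.2 ⟨θ, hθ⟩).trans_le hcard

section Approximation

variable {P} {θ θ' : Θ} {s : ℝ}

theorem abs_margin_sub_margin_le (h : ∀ x a, |P.R θ x a - P.R θ' x a| ≤ s) (z : X × A × A) :
    |P.margin θ z - P.margin θ' z| ≤ 2 * s := by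
  rw [margin, margin, sub_sub_sub_comm]
  exact (abs_sub _ _).trans (by linarith [h z.1 z.2.1, h z.1 z.2.2])

theorem marginError_le_two_mul_add (π : Kernel X A) [IsMarkovKernel π]
    (h : ∀ x a, |P.R θ x a - P.R θ' x a| ≤ s) :
    P.marginError π θ ≤ 2 * P.marginError π θ' + 8 * P.B * s := by
  have hclose (z : X × A × A) : (P.margin θ z - P.margin θ' z) ^ 2 ≤ 4 * P.B * s := by
    have hs := abs_margin_sub_margin_le h z
    have hB : |P.margin θ z - P.margin θ' z| ≤ 2 * P.B := by
      linarith [abs_sub (P.margin θ z) (P.margin θ' z), P.abs_margin_le θ z,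
        P.abs_margin_le θ' z]
    rw [← sq_abs, sq]
    linarith [mul_le_mul hB hs (abs_nonneg _) (by linarith [P.B_pos])]
  have hpointwise (z : X × A × A) : (P.margin θ z - P.margin P.θstar z) ^ 2 ≤
      2 * (P.margin θ' z - P.margin P.θstar z) ^ 2 + 8 * P.B * s := by
    have := add_sq_le (a := P.margin θ z - P.margin θ' z) (b := P.margin θ' z - P.margin P.θstar z)
    rw [sub_add_sub_cancel] at this
    linarith [hclose z]
  have hint := (P.integrable_sq_margin_sub_margin (P.d₀ ⊗ₘ (π ×ₖ π)) θ' P.θstar).const_mul 2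
  calc P.marginError π θ
      ≤ ∫ z, (2 * (P.margin θ' z - P.margin P.θstar z) ^ 2 + 8 * P.B * s)
          ∂(P.d₀ ⊗ₘ (π ×ₖ π)) :=
        integral_mono (P.integrable_sq_margin_sub_margin _ θ P.θstar)
          (hint.add (integrable_const _)) hpointwise
    _ = _ := by
        rw [integral_add hint (integrable_const _), integral_const_mul, integral_const,
          probReal_univ, one_smul, marginError]

theorem sum_logRatio_sub_le (h : ∀ x a, |P.R θ x a - P.R θ' x a| ≤ s) {k : ℕ}
    (D : Fin k → Obs X A) :
    ∑ i, P.logRatio θ (D i) - k * (2 * s) ≤ ∑ i, P.logRatio θ' (D i) := by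
  have hterm (o : Obs X A) : P.logRatio θ o - 2 * s ≤ P.logRatio θ' o := by
    have hlik := (abs_le.1 (P.abs_logLik_sub_logLik_le θ θ' o)).2
    rw [logRatio, logRatio]
    linarith [abs_margin_sub_margin_le h o.1]
  simpa [Finset.sum_sub_distrib] using Finset.sum_le_sum fun i (_ : i ∈ Finset.univ) => hterm (D i)

theorem IsFinalMLE.totalLogRatio_nonneg
    {est : (Fin m → Obs X A) × (Fin n → Obs X A) → Θ} (hmle : P.IsFinalMLE est)
    (D : (Fin m → Obs X A) × (Fin n → Obs X A)) : 0 ≤ P.totalLogRatio (est D) D := by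
  simp only [totalLogRatio, logRatio, Finset.sum_sub_distrib]
  linarith [hmle D P.θstar]

theorem IsFinalMLE.neg_le_totalLogRatio
    {est : (Fin m → Obs X A) × (Fin n → Obs X A) → Θ} (hmle : P.IsFinalMLE est)
    {D : (Fin m → Obs X A) × (Fin n → Obs X A)}
    (h : ∀ x a, |P.R (est D) x a - P.R θ' x a| ≤ s) :
    -((m + n) * (2 * s)) ≤ P.totalLogRatio θ' D := by
  have hnonneg := hmle.totalLogRatio_nonneg D
  rw [totalLogRatio] at hnonneg ⊢
  linarith [sum_logRatio_sub_le h D.1, sum_logRatio_sub_le h D.2]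

theorem IsFinalMLE.marginError_le_of_totalLogRatio_lt (hm : 0 < m)
    {est : (Fin m → Obs X A) × (Fin n → Obs X A) → Θ} (hmle : P.IsFinalMLE est)
    {D : (Fin m → Obs X A) × (Fin n → Obs X A)}
    (h : ∀ x a, |P.R (est D) x a - P.R θ' x a| ≤ s) {L : ℝ}
    (hL : P.totalLogRatio θ' D / 2 < L - m * (P.marginError P.π₀ θ' / (32 * Real.exp P.B))) :
    P.marginError P.π₀ (est D) ≤
      Real.exp P.B * (64 * (L / m) + (64 * (1 + n / m) + 8) * s) := by
  have hm' : (0 : ℝ) < m := Nat.cast_pos.2 hm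
  have hθ' : P.marginError P.π₀ θ' ≤ (L + (m + n) * s) / m * (32 * Real.exp P.B) := by
    rw [← div_le_iff₀ (by positivity), le_div_iff₀ hm']
    linarith [hmle.neg_le_totalLogRatio h]
  have hs : 0 ≤ s := by
    obtain ⟨x⟩ := P.d₀.nonempty_of_neZero
    obtain ⟨a⟩ := (P.π₀ x).nonempty_of_neZero
    exact (abs_nonneg _).trans (h x a)
  have hB : P.B * s ≤ Real.exp P.B * s :=
    mul_le_mul_of_nonneg_right (by linarith [Real.add_one_le_exp P.B]) hs
  calc P.marginError P.π₀ (est D)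
      ≤ 2 * ((L + (m + n) * s) / m * (32 * Real.exp P.B)) + 8 * (Real.exp P.B * s) := by
        linarith [marginError_le_two_mul_add P.π₀ h]
    _ = _ := by field_simp; ring

theorem IsFinalMLE.runLaw_marginError_le (hm : 0 < m) {est₀ : (Fin m → Obs X A) → Θ}
    (h₀ : Measurable est₀) {est : (Fin m → Obs X A) × (Fin n → Obs X A) → Θ}
    (hmle : P.IsFinalMLE est) {δ r : ℝ} (hδ : 0 < δ) (hN : P.coveringNumber r ≠ ⊤) :
    ENNReal.ofReal (1 - δ) ≤ P.runLaw m n est₀ h₀ {D | P.marginError P.π₀ (est D) ≤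
      Real.exp P.B * (64 * (Real.log ((P.coveringNumber r).toNat / δ) / m) +
        (64 * (1 + n / m) + 8) * (2 * r))} := by
  obtain ⟨T, hcard, hT⟩ := P.exists_finset_cover hN
  have : IsProbabilityMeasure (P.runLaw m n est₀ h₀) := by rw [runLaw]; infer_instance
  have hN₁ : (0 : ℝ) < (P.coveringNumber r).toNat :=
    Nat.cast_pos.2 (P.one_le_toNat_coveringNumber hN)
  set L := Real.log ((P.coveringNumber r).toNat / δ) with hL
  refine ofReal_one_sub_le_measure_of_compl_subset_biUnion (T := T) (bad := fun θ =>
    {D | L - m * (P.marginError P.π₀ θ / (32 * Real.exp P.B)) ≤ P.totalLogRatio θ D / 2})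
    hδ.le (fun D hD => ?_) fun θ hθ => ?_
  · obtain ⟨θ, hθ, hclose⟩ := hT (est D)
    by_contra hnotbad
    exact hD (hmle.marginError_le_of_totalLogRatio_lt hm hclose
      (not_le.1 fun hle => hnotbad (Set.mem_biUnion hθ hle)))
  · refine (P.runLaw_sub_le_half_totalLogRatio_le est₀ h₀ θ L).trans
      (ENNReal.ofReal_le_ofReal ?_)
    have hT₀ : (0 : ℝ) < T.card := Nat.cast_pos.2 (Finset.card_pos.2 ⟨θ, hθ⟩)
    rw [hL, Real.exp_neg, Real.exp_log (by positivity), inv_div]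
    gcongr

end Approximation

/-! ### Suboptimality of Gibbs policies -/

section Suboptimality

open InformationTheory (klDiv klDiv_self klDiv_ne_top_iff toReal_klDiv_of_measure_eq)

variable {π : Kernel X A} {C ρ : ℝ}

/-- The logarithm of the normalizing constant of the policy `π_θ^η(·|x)`. -/
noncomputable def logPartition (θ : Θ) (x : X) : ℝ :=
  Real.log (∫ a, Real.exp (P.η * P.R θ x a) ∂P.π₀ x)

/-- The coverage condition on the Gibbs policies alone: `π_θ^η(a|x) ≤ C π₀(a|x)` for every
parameter `θ`, almost every context `x` and every action `a`. -/
def GibbsCoveredBy (C : ℝ) : Prop :=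
  ∀ θ, ∀ᵐ x ∂P.d₀, ∀ a, (P.policy θ x).real {a} ≤ C * (P.π₀ x).real {a}

theorem policy_apply (θ : Θ) (x : X) :
    P.policy θ x = (P.π₀ x).tilted fun a => P.η * P.R θ x a := rfl

theorem integrable_R (μ : Measure A) [IsFiniteMeasure μ] (θ : Θ) (x : X) :
    Integrable (P.R θ x) μ :=
  integrable_of_measurable_of_abs_le (P.measurable_R_apply_apply θ x) (P.abs_R_le θ x)

theorem exp_mul_R_mem_Icc (θ : Θ) (x : X) (a : A) :
    Real.exp (P.η * P.R θ x a) ∈ Set.Icc 1 (Real.exp (P.η * P.B)) :=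
  ⟨Real.one_le_exp (mul_nonneg P.η_pos.le (P.R_nonneg θ x a)),
    Real.exp_le_exp.2 (mul_le_mul_of_nonneg_left (P.R_le θ x a) P.η_pos.le)⟩

theorem integrable_exp_mul_R (μ : Measure A) [IsFiniteMeasure μ] (θ : Θ) (x : X) :
    Integrable (fun a => Real.exp (P.η * P.R θ x a)) μ :=
  integrable_of_measurable_of_abs_le ((P.measurable_R_apply_apply θ x).const_mul _).exp
    fun a => by rw [Real.abs_exp]; exact (P.exp_mul_R_mem_Icc θ x a).2

theorem logPartition_mem_Icc (θ : Θ) (x : X) : P.logPartition θ x ∈ Set.Icc 0 (P.η * P.B) := by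
  have hint := P.integrable_exp_mul_R (P.π₀ x) θ x
  have hone : 1 ≤ ∫ a, Real.exp (P.η * P.R θ x a) ∂P.π₀ x := by
    simpa using integral_mono (integrable_const 1) hint fun a => (P.exp_mul_R_mem_Icc θ x a).1
  have hexp : ∫ a, Real.exp (P.η * P.R θ x a) ∂P.π₀ x ≤ Real.exp (P.η * P.B) := by
    simpa using integral_mono hint (integrable_const _) fun a => (P.exp_mul_R_mem_Icc θ x a).2
  exact ⟨Real.log_nonneg hone, (Real.log_le_iff_le_exp (zero_lt_one.trans_le hone)).2 hexp⟩

theorem integrable_logPartition (θ : Θ) : Integrable (P.logPartition θ) P.d₀ := by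
  refine integrable_of_measurable_of_abs_le (b := P.η * P.B) ?_ fun x => ?_
  · have hexp := ((P.measurable_R_apply θ).const_mul P.η).exp.stronglyMeasurable
    exact (hexp.integral_kernel_prod_right' (κ := P.π₀)).measurable.log
  · obtain ⟨hnonneg, hle⟩ := P.logPartition_mem_Icc θ x
    rwa [abs_of_nonneg hnonneg]

theorem klDiv_policy_le (θ : Θ) (x : X) :
    klDiv (P.policy θ x) (P.π₀ x) ≤ ENNReal.ofReal (P.η * P.B) := by
  rw [policy_apply, ← sub_zero (P.η * P.B)]
  exact klDiv_tilted_self_le ((P.measurable_R_apply_apply θ x).const_mul P.η)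
    (fun a => mul_nonneg P.η_pos.le (P.R_nonneg θ x a))
    (fun a => mul_le_mul_of_nonneg_left (P.R_le θ x a) P.η_pos.le)

theorem integrable_toReal_klDiv_policy (θ θ' : Θ) :
    Integrable (fun x => (klDiv (P.policy θ x) (P.policy θ' x)).toReal)
      P.d₀ := by
  have hformula (x : X) : (klDiv (P.policy θ x) (P.policy θ' x)).toReal =
      ∫ a, (P.η * P.R θ x a - P.η * P.R θ' x a) ∂(P.policy θ x) -
        (P.logPartition θ x - P.logPartition θ' x) :=
    toReal_klDiv_tilted_tilted (P.integrable_exp_mul_R _ θ x) (P.integrable_exp_mul_R _ θ' x)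
      ((P.integrable_R (P.policy θ x) θ x).const_mul _)
      ((P.integrable_R (P.policy θ x) θ' x).const_mul _)
  simp only [hformula]
  refine Integrable.sub (integrable_integral_kernel (b := P.η * (2 * P.B))
    (h := fun z : X × A => P.η * P.R θ z.1 z.2 - P.η * P.R θ' z.1 z.2)
    (((P.measurable_R_apply θ).const_mul _).sub ((P.measurable_R_apply θ').const_mul _))
    fun z => ?_) ((P.integrable_logPartition θ).sub (P.integrable_logPartition θ'))
  rw [← mul_sub, abs_mul, abs_of_pos P.η_pos]
  refine mul_le_mul_of_nonneg_left ?_ P.η_pos.le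
  linarith [abs_sub (P.R θ z.1 z.2) (P.R θ' z.1 z.2), P.abs_R_le θ z.1 z.2, P.abs_R_le θ' z.1 z.2]

theorem integral_R_sub_log_eq [Countable A] [MeasurableSingletonClass A] [IsMarkovKernel π] {x : X}
    (hkl : klDiv (π x) (P.π₀ x) ≠ ⊤) :
    ∫ a, (P.R P.θstar x a - P.η⁻¹ * Real.log ((π x).real {a} / (P.π₀ x).real {a})) ∂(π x) =
      P.η⁻¹ * (P.logPartition P.θstar x -
        (klDiv (π x) (P.policy P.θstar x)).toReal) := by
  obtain ⟨hac, hllr⟩ := klDiv_ne_top_iff.1 hkl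
  have hR := P.integrable_R (π x) P.θstar x
  have hgibbs := integral_sub_toReal_klDiv_eq_log_integral_exp_sub hkl (hR.const_mul P.η)
    (P.integrable_exp_mul_R (P.π₀ x) P.θstar x)
  have hcongr : ∫ a, (P.R P.θstar x a -
      P.η⁻¹ * Real.log ((π x).real {a} / (P.π₀ x).real {a})) ∂(π x) =
        ∫ a, (P.R P.θstar x a - P.η⁻¹ * llr (π x) (P.π₀ x) a) ∂(π x) := by
    refine integral_congr_ae ?_
    filter_upwards [log_real_singleton_div_ae_eq_llr hac] with a ha
    rw [ha]
  rw [logPartition, policy_apply, ← hgibbs, hcongr, integral_sub hR (hllr.const_mul _),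
    integral_const_mul, integral_const_mul,
    toReal_klDiv_of_measure_eq hac (by simp), mul_sub,
    inv_mul_cancel_left₀ P.η_pos.ne']

theorem objective_eq [Countable A] [MeasurableSingletonClass A] [IsMarkovKernel π]
    (hkl : ∀ᵐ x ∂P.d₀, klDiv (π x) (P.π₀ x) ≠ ⊤) :
    P.objective π = P.η⁻¹ * ∫ x, (P.logPartition P.θstar x -
      (klDiv (π x) (P.policy P.θstar x)).toReal) ∂P.d₀ := by
  rw [objective, ← integral_const_mul]
  refine integral_congr_ae ?_
  filter_upwards [hkl] with x hx
  exact P.integral_R_sub_log_eq hx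

theorem gap_eq_integral_toReal_klDiv [Countable A] [MeasurableSingletonClass A] (θ : Θ) :
    P.gap θ = P.η⁻¹ *
      ∫ x, (klDiv (P.policy θ x) (P.policy P.θstar x)).toReal ∂P.d₀ := by
  have hkl (θ : Θ) : ∀ᵐ x ∂P.d₀, klDiv (P.policy θ x) (P.π₀ x) ≠ ⊤ :=
    ae_of_all _ fun x => ne_top_of_le_ne_top ENNReal.ofReal_ne_top (P.klDiv_policy_le θ x)
  rw [gap, P.objective_eq (hkl P.θstar), P.objective_eq (hkl θ),
    integral_sub (P.integrable_logPartition _) (P.integrable_toReal_klDiv_policy θ P.θstar)]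
  simp only [klDiv_self, ENNReal.toReal_zero, sub_zero]
  ring

theorem integral_sq_margin_sub_margin_eq_two_mul_variance (θ θ' : Θ) (x : X) (μ : Measure A)
    [IsProbabilityMeasure μ] :
    ∫ z, (P.margin θ (x, z) - P.margin θ' (x, z)) ^ 2 ∂(μ.prod μ) =
      2 * Var[P.R θ x - P.R θ' x; μ] := by
  have hmem (θ : Θ) : MemLp (P.R θ x) 2 μ :=
    .of_bound (P.measurable_R_apply_apply θ x).aestronglyMeasurable P.B
      (ae_of_all _ (P.abs_R_le θ x))
  rw [← integral_prod_sub_sq_eq_two_mul_variance ((hmem θ).sub (hmem θ'))]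
  simp only [margin, Pi.sub_apply, sub_sub_sub_comm]

namespace GibbsCoveredBy

variable {P} [Countable A] [MeasurableSingletonClass A]

theorem ae_density_le (hC : P.GibbsCoveredBy C)
    (θ : Θ) : ∀ᵐ x ∂P.d₀, ∀ᵐ a ∂P.π₀ x,
      Real.exp (P.η * P.R θ x a) / ∫ b, Real.exp (P.η * P.R θ x b) ∂P.π₀ x ≤ C := by
  filter_upwards [hC θ] with x hx
  refine ae_iff_of_countable.2 fun a ha => ?_
  have hpos : 0 < (P.π₀ x).real {a} := ENNReal.toReal_pos ha (measure_ne_top _ _)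
  have hle := hx a
  rw [policy_apply, tilted_real_singleton] at hle
  exact le_of_mul_le_mul_right hle hpos

theorem pos (hC : P.GibbsCoveredBy C) : 0 < C := by
  obtain ⟨x, hx⟩ := (hC.ae_density_le P.θstar).exists
  obtain ⟨a, ha⟩ := hx.exists
  exact (div_pos (Real.exp_pos _)
    (integral_exp_pos (P.integrable_exp_mul_R _ P.θstar x))).trans_le ha

theorem ae_toReal_klDiv_policy_le (hC : P.GibbsCoveredBy C) (θ θ' : Θ) : ∀ᵐ x ∂P.d₀,
      (klDiv (P.policy θ x) (P.policy θ' x)).toReal ≤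
        C * (P.η ^ 2 * Var[P.R θ x - P.R θ' x; P.π₀ x]) := by
  filter_upwards [hC.ae_density_le θ, hC.ae_density_le θ'] with x hθ hθ'
  have hsub : (fun a => P.η * P.R θ x a) - (fun a => P.η * P.R θ' x a) =
      fun a => P.η * (P.R θ x - P.R θ' x) a := by
    funext a
    simp only [Pi.sub_apply, mul_sub]
  have hmem (θ : Θ) : MemLp (fun a => P.η * P.R θ x a) 2 (P.π₀ x) :=
    (MemLp.of_bound (P.measurable_R_apply_apply θ x).aestronglyMeasurable P.B
      (ae_of_all _ (P.abs_R_le θ x))).const_mul _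
  have hkl := toReal_klDiv_tilted_tilted_le_mul_variance (P.integrable_exp_mul_R _ θ x)
    (P.integrable_exp_mul_R _ θ' x) ((hmem θ).sub (hmem θ')) hθ hθ'
  rwa [hsub, variance_const_mul] at hkl

theorem gap_le (hC : P.GibbsCoveredBy C) (θ : Θ) :
    P.gap θ ≤ P.η * C / 2 * P.marginError P.π₀ θ := by
  have hint : Integrable (fun x => ∫ z, (P.margin θ (x, z) - P.margin P.θstar (x, z)) ^ 2
      ∂((P.π₀ ×ₖ P.π₀) x)) P.d₀ :=
    integrable_integral_kernel (P.measurable_sq_margin_sub_margin θ P.θstar)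
      (P.abs_sq_margin_sub_margin_le θ P.θstar)
  calc P.gap θ
      = P.η⁻¹ * ∫ x, (klDiv (P.policy θ x) (P.policy P.θstar x)).toReal
          ∂P.d₀ := P.gap_eq_integral_toReal_klDiv θ
    _ ≤ P.η⁻¹ * ∫ x, C * P.η ^ 2 / 2 * ∫ z, (P.margin θ (x, z) - P.margin P.θstar (x, z)) ^ 2
          ∂((P.π₀ ×ₖ P.π₀) x) ∂P.d₀ := by
        refine mul_le_mul_of_nonneg_left (integral_mono_ae
          (P.integrable_toReal_klDiv_policy θ P.θstar) (hint.const_mul _) ?_)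
          (inv_nonneg.2 P.η_pos.le)
        filter_upwards [hC.ae_toReal_klDiv_policy_le θ P.θstar] with x hx
        rw [Kernel.prod_apply, integral_sq_margin_sub_margin_eq_two_mul_variance]
        linarith
    _ = P.η * C / 2 * P.marginError P.π₀ θ := by
        rw [integral_const_mul, marginError,
          Measure.integral_compProd (P.integrable_sq_margin_sub_margin _ θ P.θstar)]
        field_simp [P.η_pos.ne']

end GibbsCoveredBy

theorem ae_real_singleton_le_localCoverage_mul [IsMarkovKernel π] (hC : P.localCoverage ρ ≠ ⊤)
    (hkl : ∫⁻ x, klDiv (π x) (P.π₀ x) ∂P.d₀ ≤ ENNReal.ofReal ρ) :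
    ∀ᵐ x ∂P.d₀, ∀ a, (π x).real {a} ≤ (P.localCoverage ρ).toReal * (P.π₀ x).real {a} := by
  have hess : essSup (fun x => ⨆ a, π x {a} / P.π₀ x {a}) P.d₀ ≤ P.localCoverage ρ :=
    le_iSup_of_le π (le_iSup_of_le inferInstance (le_iSup_of_le hkl le_rfl))
  filter_upwards [ENNReal.ae_le_essSup fun x => ⨆ a, π x {a} / P.π₀ x {a}] with x hx a
  have hratio : π x {a} / P.π₀ x {a} ≤ P.localCoverage ρ :=
    (le_iSup (fun a => π x {a} / P.π₀ x {a}) a).trans (hx.trans hess)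
  have hle : π x {a} ≤ P.localCoverage ρ * P.π₀ x {a} :=
    (ENNReal.div_le_iff_le_mul (.inr hC) (.inl (measure_ne_top _ _))).1 hratio
  rw [Measure.real, Measure.real, ← ENNReal.toReal_mul]
  exact ENNReal.toReal_mono (ENNReal.mul_ne_top hC (measure_ne_top _ _)) hle

theorem gibbsCoveredBy_localCoverage (hρ : P.η * P.B ≤ ρ) (hC : P.localCoverage ρ ≠ ⊤) :
    P.GibbsCoveredBy (P.localCoverage ρ).toReal := fun θ => by
  refine P.ae_real_singleton_le_localCoverage_mul hC ?_
  calc ∫⁻ x, klDiv (P.policy θ x) (P.π₀ x) ∂P.d₀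
      ≤ ∫⁻ _, ENNReal.ofReal (P.η * P.B) ∂P.d₀ := lintegral_mono (P.klDiv_policy_le θ)
    _ ≤ ENNReal.ofReal ρ := by simpa using ENNReal.ofReal_le_ofReal hρ

variable {P} in
theorem IsFinalMLE.runLaw_gap_le [Countable A] [MeasurableSingletonClass A]
    (hC : P.GibbsCoveredBy C) {est₀ : (Fin m → Obs X A) → Θ} (h₀ : Measurable est₀)
    {est : (Fin m → Obs X A) × (Fin n → Obs X A) → Θ} (hmle : P.IsFinalMLE est)
    {c κ ε δ r : ℝ} (hκ : 0 < κ) (hε : 0 < ε) (hδ : 0 < δ) (hδ₁ : δ < 1) (hr : 0 ≤ r)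
    (hN : P.coveringNumber r ≠ ⊤) (hmn : (n : ℝ) ≤ c * m)
    (hn : κ * (C * P.η / ε * Real.exp P.B * Real.log ((P.coveringNumber r).toNat / δ)) ≤ n) :
    ENNReal.ofReal (1 - δ) ≤ P.runLaw m n est₀ h₀ {D | P.gap (est D) ≤
      32 * c / κ * ε + (64 * (1 + c) + 8) * (P.η * C * Real.exp P.B * r)} := by
  have hCpos := hC.pos
  have hη := P.η_pos
  have hN₁ : (1 : ℝ) ≤ (P.coveringNumber r).toNat :=
    Nat.one_le_cast.2 (P.one_le_toNat_coveringNumber hN)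
  have hL : 0 < Real.log ((P.coveringNumber r).toNat / δ) :=
    Real.log_pos ((one_lt_div hδ).2 (hδ₁.trans_le hN₁))
  set L := Real.log ((P.coveringNumber r).toNat / δ)
  have hm : 0 < m := Nat.pos_of_ne_zero fun hm => by
    have hpos : 0 < κ * (C * P.η / ε * Real.exp P.B * L) := by positivity
    rw [hm, Nat.cast_zero, mul_zero] at hmn
    linarith
  have hm' : (0 : ℝ) < m := Nat.cast_pos.2 hm
  have hstat : P.η * C * Real.exp P.B * (L / m) ≤ c / κ * ε := by
    calc P.η * C * Real.exp P.B * (L / m)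
        = κ * (C * P.η / ε * Real.exp P.B * L) * (ε / (κ * m)) := by field_simp
      _ ≤ c * m * (ε / (κ * m)) := mul_le_mul_of_nonneg_right (hn.trans hmn) (by positivity)
      _ = c / κ * ε := by field_simp
  have happrox : (64 * (1 + n / m) + 8) * (P.η * C * Real.exp P.B * r) ≤
      (64 * (1 + c) + 8) * (P.η * C * Real.exp P.B * r) := by
    gcongr
    exact (div_le_iff₀ hm').2 hmn
  refine (hmle.runLaw_marginError_le hm h₀ hδ hN).trans
    (measure_mono (Set.ofPred_subset_ofPred.2 fun D hD => ?_))
  calc P.gap (est D) ≤ P.η * C / 2 * P.marginError P.π₀ (est D) := hC.gap_le _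
    _ ≤ P.η * C / 2 * (Real.exp P.B * (64 * (L / m) + (64 * (1 + n / m) + 8) * (2 * r))) := by
        gcongr
    _ = 32 * (P.η * C * Real.exp P.B * (L / m)) +
          (64 * (1 + n / m) + 8) * (P.η * C * Real.exp P.B * r) := by ring
    _ ≤ 32 * (c / κ * ε) + (64 * (1 + c) + 8) * (P.η * C * Real.exp P.B * r) := by gcongr
    _ = _ := by ring

end Suboptimality

end PrefProblem

theorem mainTheorem6_general (c κ : ℝ) (hc : 0 < c) (hκ : 0 < κ) :
    ∃ K : ℝ, 0 < K ∧
      ∀ (X : Type*) (A : Type*) (Θ : Type*) [MeasurableSpace X] [MeasurableSpace A]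
        [MeasurableSpace Θ] [Countable A] [MeasurableSingletonClass A]
        (P : PrefProblem X A Θ) (C : ℝ) (_hC : P.GibbsCoveredBy C)
        (ε δ : ℝ) (_hε : 0 < ε) (_hδ : 0 < δ) (_hδ₁ : δ < 1)
        (m n : ℕ) (_hmn : (n : ℝ) ≤ c * m)
        (est₀ : (Fin m → Obs X A) → Θ) (h₀ : Measurable est₀)
        (est : (Fin m → Obs X A) × (Fin n → Obs X A) → Θ) (_hmle : P.IsFinalMLE est),
        (∀ εc : ℝ, εc = ε / (2 * (1 + c⁻¹) * Real.exp P.B) → P.coveringNumber εc ≠ ⊤ →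
          κ * (C * P.η / ε * Real.exp P.B * Real.log ((P.coveringNumber εc).toNat / δ)) ≤ n →
          ENNReal.ofReal (1 - δ) ≤ P.runLaw m n est₀ h₀
            {D | P.gap (est D) ≤ K * (1 + P.η * C) * ε}) ∧
        (∀ εc : ℝ, εc = ε / (2 * (1 + c⁻¹) * Real.exp P.B * (P.η * C)) →
          P.coveringNumber εc ≠ ⊤ →
          κ * (C * P.η / ε * Real.exp P.B * Real.log ((P.coveringNumber εc).toNat / δ)) ≤ n →
          ENNReal.ofReal (1 - δ) ≤ P.runLaw m n est₀ h₀ {D | P.gap (est D) ≤ K * ε}) := by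
  refine ⟨32 * c / κ + (64 * (1 + c) + 8), by positivity, ?_⟩
  intro X A Θ _ _ _ _ _ P C hC ε δ hε hδ hδ₁ m n hmn est₀ h₀ est hmle
  have hη := P.η_pos
  have hCpos := hC.pos
  have hηC : 0 < P.η * C := mul_pos hη hCpos
  have hhalf : ε / (2 * (1 + c⁻¹)) ≤ ε := div_le_self hε.le (by linarith [inv_pos.2 hc])
  have hbound {t εc : ℝ} (hεt : ε ≤ t) (hεc : P.η * C * Real.exp P.B * εc ≤ t) :
      32 * c / κ * ε + (64 * (1 + c) + 8) * (P.η * C * Real.exp P.B * εc) ≤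
        (32 * c / κ + (64 * (1 + c) + 8)) * t :=
    (add_le_add (mul_le_mul_of_nonneg_left hεt (by positivity))
      (mul_le_mul_of_nonneg_left hεc (by positivity))).trans_eq (add_mul _ _ _).symm
  refine ⟨fun εc hεc hN hn => ?_, fun εc hεc hN hn => ?_⟩ <;>
    refine (hmle.runLaw_gap_le hC h₀ hκ hε hδ hδ₁ (hεc ▸ by positivity) hN hmn hn).trans
      (measure_mono (Set.ofPred_subset_ofPred.2 fun D hD => hD.trans ?_))
  · have hr : P.η * C * Real.exp P.B * εc = P.η * C * (ε / (2 * (1 + c⁻¹))) := by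
      rw [hεc]
      field_simp
    rw [mul_assoc (_ + _)]
    refine hbound ?_ (hr.trans_le ?_)
    · linarith [mul_pos hηC hε]
    · linarith [mul_le_mul_of_nonneg_left hhalf hηC.le]
  · have hr : P.η * C * Real.exp P.B * εc = ε / (2 * (1 + c⁻¹)) := by
      rw [hεc]
      field_simp
    exact hbound le_rfl (hr.trans_le hhalf)

theorem mainTheorem6 (c κ : ℝ) (hc : 0 < c) (hκ : 0 < κ) :
    ∃ K : ℝ, 0 < K ∧
      ∀ (X : Type*) (A : Type*) (Θ : Type*) [MeasurableSpace X] [MeasurableSpace A]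
        [MeasurableSpace Θ] [Countable A] [MeasurableSingletonClass A]
        (P : PrefProblem X A Θ) (_hC : P.localCoverage (2 * P.η * P.B) ≠ ⊤)
        (ε δ : ℝ) (_hε : 0 < ε) (_hδ : 0 < δ) (_hδ' : δ < 1 / 6)
        (m n : ℕ) (_hmn : (n : ℝ) = c * m)
        (est₀ : (Fin m → Obs X A) → Θ) (h₀ : Measurable est₀) (_hmle₀ : P.IsFirstMLE est₀)
        (est : (Fin m → Obs X A) × (Fin n → Obs X A) → Θ) (_h : Measurable est)
        (_hmle : P.IsFinalMLE est),
        (∀ εc : ℝ, εc = ε / (2 * (1 + c⁻¹) * Real.exp P.B) →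
          P.coveringNumber εc ≠ ⊤ → κ * P.sampleSize ε δ εc ≤ n →
          ENNReal.ofReal (1 - 6 * δ) ≤ P.runLaw m n est₀ h₀
            {D | P.gap (est D) ≤
              K * (1 + P.η * (P.localCoverage (2 * P.η * P.B)).toReal) * ε}) ∧
        (∀ εc : ℝ, εc = ε / (2 * (1 + c⁻¹) * Real.exp P.B *
              (P.η * (P.localCoverage (2 * P.η * P.B)).toReal)) →
          P.coveringNumber εc ≠ ⊤ → κ * P.sampleSize ε δ εc ≤ n →
          ENNReal.ofReal (1 - 6 * δ) ≤ P.runLaw m n est₀ h₀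
            {D | P.gap (est D) ≤ K * ε}) := by
  obtain ⟨K, hK, hgeneral⟩ := mainTheorem6_general c κ hc hκ
  refine ⟨K, hK, fun X A Θ _ _ _ _ _ P hC ε δ hε hδ hδ' m n hmn est₀ h₀ _ est _ hmle => ?_⟩
  have hρ : P.η * P.B ≤ 2 * P.η * P.B := by linarith [mul_pos P.η_pos P.B_pos]
  have hprob : ENNReal.ofReal (1 - 6 * δ) ≤ ENNReal.ofReal (1 - δ) :=
    ENNReal.ofReal_le_ofReal (by linarith)
  obtain ⟨hfixed, hscaled⟩ := hgeneral X A Θ P _ (P.gibbsCoveredBy_localCoverage hρ hC) ε δ hε hδ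
    (by linarith) m n hmn.le est₀ h₀ est hmle
  exact ⟨fun εc hεc hN hn => hprob.trans (hfixed εc hεc hN hn),
    fun εc hεc hN hn => hprob.trans (hscaled εc hεc hN hn)⟩
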